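/- **Setting.** Formulas are the terms over a countably infinite set of propositional variables in the language $\wedge,\vee,\cdot,\backslash,/,{}^*,0,1$; a sequent $\Gamma\Rightarrow\beta$ consists of a finite sequence $\Gamma$ of formulas and a formula $\beta$. Fix countably infinite disjoint sets of formula metavariables and of sequence metavariables. A *schematic rule* has finitely many premises and a conclusion, each made of a finite sequence of sequence metavariables and metaformulas (terms over the formula metavariables) and a metaformula on the right; its instances arise by instantiating formula metavariables by formulas and sequence metavariables by finite sequences of formulas. A *structural rule* is a schematic rule in which every left-hand side is a sequence of (formula or sequence) metavariables and every right-hand side is a formula metavariable. It is *linear* if the left-hand side of its conclusion consists of pairwise distinct sequence metavariables. The *identity axiom* is $a\Rightarrow a$ for propositional variables $a$. The *principal rules* are the following (premises before the slash; the principal formula is the one in the conclusion that shows the connective; the auxiliary formulas are its displayed constituents in the premises, which for ${*}\mathrm L$ are both $\alpha$ and $\alpha^*$ in the second premise, and for ${*}\mathrm R_1$ are $\beta$ and $\beta^*$): - $0\mathrm L$: $\;/\;\Gamma,0,\Delta\Rightarrow\beta$; $\quad 1\mathrm L$: $\Gamma,\Delta\Rightarrow\beta\;/\;\Gamma,1,\Delta\Rightarrow\beta$;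 $\quad 1\mathrm R$: $\;/\;\Rightarrow 1$; - $\wedge\mathrm L_i$: $\Gamma,\alpha_i,\Delta\Rightarrow\beta\;/\;\Gamma,\alpha_0\wedge\alpha_1,\Delta\Rightarrow\beta$ $(i=0,1)$; $\quad\wedge\mathrm R$: $\Gamma\Rightarrow\beta_0$ and $\Gamma\Rightarrow\beta_1\;/\;\Gamma\Rightarrow\beta_0\wedge\beta_1$; - $\vee\mathrm L$: $\Gamma,\alpha_0,\Delta\Rightarrow\beta$ and $\Gamma,\alpha_1,\Delta\Rightarrow\beta\;/\;\Gamma,\alpha_0\vee\alpha_1,\Delta\Rightarrow\beta$; $\quad\vee\mathrm R_i$: $\Gamma\Rightarrow\beta_i\;/\;\Gamma\Rightarrow\beta_0\vee\beta_1$ $(i=0,1)$; - ${\cdot}\mathrm L$: $\Gamma,\alpha_0,\alpha_1,\Delta\Rightarrow\beta\;/\;\Gamma,\alpha_0\cdot\alpha_1,\Delta\Rightarrow\beta$; $\quad{\cdot}\mathrm R$: $\Gamma\Rightarrow\beta_0$ and $\Delta\Rightarrow\beta_1\;/\;\Gamma,\Delta\Rightarrow\beta_0\cdot\beta_1$; -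 $\backslash\mathrm L$: $\Delta\Rightarrow\alpha_0$ and $\Gamma,\alpha_1,\Sigma\Rightarrow\beta\;/\;\Gamma,\Delta,\alpha_0\backslash\alpha_1,\Sigma\Rightarrow\beta$; $\quad\backslash\mathrm R$: $\beta_0,\Gamma\Rightarrow\beta_1\;/\;\Gamma\Rightarrow\beta_0\backslash\beta_1$; - $/\mathrm L$: $\Delta\Rightarrow\alpha_0$ and $\Gamma,\alpha_1,\Sigma\Rightarrow\beta\;/\;\Gamma,\alpha_1/\alpha_0,\Delta,\Sigma\Rightarrow\beta$; $\quad/\mathrm R$: $\Gamma,\beta_0\Rightarrow\beta_1\;/\;\Gamma\Rightarrow\beta_1/\beta_0$; - ${*}\mathrm R_0$: $\;/\;\Rightarrow\beta^*$; $\quad{*}\mathrm R_1$: $\Gamma\Rightarrow\beta$ and $\Delta\Rightarrow\beta^*\;/\;\Gamma,\Delta\Rightarrow\beta^*$; - ${*}\mathrm L_\omega$: $\Gamma,\alpha^{(n)},\Delta\Rightarrow\beta$ for all $n\in\mathbb N$ $\;/\;\Gamma,\alpha^*,\Delta\Rightarrow\beta$, where $\alpha^{(n)}$ is the sequence $\alpha,\dots,\alpha$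 of length $n$; - ${*}\mathrm L$: $\Gamma,\Delta\Rightarrow\beta$ and $\Gamma,\alpha,\alpha^*,\Delta\Rightarrow\beta\;/\;\Gamma,\alpha^*,\Delta\Rightarrow\beta$. A *preproof* is a possibly non-wellfounded tree whose nodes are labelled by rule instances (each given with its instantiation), such that the children of a node carry exactly the premises of its instance; it is a preproof of the sequent at its root. A *branch* is an infinite path from the root. For a rule instance, an occurrence in a premise is an *immediate ancestor* of an occurrence in the conclusion if the former is auxiliary and the latter principal, or both come from the same formula metavariable, or both come from the same position in the instantiation of the same sequence metavariable (structural rules have no principal or auxiliary formulas). A *thread* along a branch chooses, at each node of a non-empty interval of the branch, a formula occurrence in the sequent at this node, so that each chosen occurrence is an immediate ancestor of the previous one. A thread is *progressing* if it has a suffix that always denotes one and the same formula of the form $\alpha^*$, always on the left-hand side, and that is principal infinitely often. For a set $\mathcal R$ of linear rules, the *wellfounded system plus $\mathcal R$* has as rules the identity axiom, $\mathcal R$, and all principal rules except ${*}\mathrm L$; its proofs are the preproofs without branches. The *non-wellfounded system plus $\mathcal R$* has as rules the identity axiom, $\mathcal R$, and all principal rules except ${*}\mathrm L_\omega$; its proofs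 are the preproofs in which every branch has a progressing thread. **Theorem.** Let $\mathcal R$ be any set of linear rules. For every sequent $S$, there is a proof of $S$ in the wellfounded system plus $\mathcal R$ if and only if there is a proof of $S$ in the non-wellfounded system plus $\mathcal R$. -/

import Mathlib

namespace ActionLat

/-- Terms over a set `V` of generators: the absolutely free algebra over the language
`∧, ∨, ·, \, /, *, 0, 1`. `ldiv a b` is `a \ b` and `rdiv b a` is `b / a`. -/
inductive Term (V : Type) : Type
  | var (x : V)
  | zero
  | one
  | meet (a b : Term V)
  | join (a b : Term V)
  | mul (a b : Term V)
  | ldiv (a b : Term V)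
  | rdiv (b a : Term V)
  | star (a : Term V)

/-- The homomorphic extension of a map from the generators to terms. -/
def Term.subst {V W : Type} (σ : V → Term W) : Term V → Term W
  | .var x => σ x
  | .zero => .zero
  | .one => .one
  | .meet a b => .meet (a.subst σ) (b.subst σ)
  | .join a b => .join (a.subst σ) (b.subst σ)
  | .mul a b => .mul (a.subst σ) (b.subst σ)
  | .ldiv a b => .ldiv (a.subst σ) (b.subst σ)
  | .rdiv b a => .rdiv (b.subst σ) (a.subst σ)
  | .star a => .star (a.subst σ)

/-- Propositional variables (a countably infinite set). -/
abbrev PVar : Type := ℕ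

/-- Formula metavariables (a countably infinite set). -/
abbrev FVar : Type := ℕ

/-- Sequence metavariables (a countably infinite set). -/
abbrev SVar : Type := ℕ

abbrev Formula : Type := Term PVar

abbrev Metaformula : Type := Term FVar

/-- A sequent `ant ⇒ suc`. -/
structure Sequent where
  ant : List Formula
  suc : Formula

/-- Positions in a sequent: `left i` is the `i`-th formula of the antecedent (counted from `0`),
`right` is the succedent (the position written `-1` on paper). -/
inductive Occ : Type
  | left (i : ℕ)
  | right

/-- The formula at a position; `none` if the position is not a formula occurrence of `S`. -/
def Sequent.get (S : Sequent) : Occ → Option Formula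
  | .left i => S.ant[i]?
  | .right => some S.suc

/-! ### Schematic rules -/

/-- A metaformula displayed in a schematic rule, together with the information whether it is boxed.
The boxed formula of the conclusion is the principal one, those of the premises are the auxiliary
ones. -/
structure Marked where
  fm : Metaformula
  boxed : Bool

/-- A boxed metaformula. -/
def box (φ : Metaformula) : Marked := ⟨φ, true⟩

/-- A metaformula without a box. -/
def plain (φ : Metaformula) : Marked := ⟨φ, false⟩

/-- The entries of the antecedent of a schematic sequent. -/
inductive Item : Type
  | seq (x : SVar)
  | form (m : Marked)

structure SchematicSequent where
  ant : List Item
  suc : Marked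

/-- A schematic rule with finitely many premises. -/
structure SchematicRule where
  premises : List SchematicSequent
  concl : SchematicSequent

/-- A metavariable instantiation. -/
structure Instantiation where
  form : FVar → Formula
  seq : SVar → List Formula

def Item.inst (σ : Instantiation) : Item → List Formula
  | .seq x => σ.seq x
  | .form m => [m.fm.subst σ.form]

def SchematicSequent.inst (σ : Instantiation) (S : SchematicSequent) : Sequent :=
  ⟨S.ant.flatMap (Item.inst σ), S.suc.fm.subst σ.form⟩

/-- Where a formula occurrence of an instantiated schematic sequent comes from: from the `p`-th
formula of the instantiation of the sequence metavariable `x`, or from a displayed metaformula. -/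
inductive Origin : Type
  | seq (x : SVar) (p : ℕ)
  | form (m : Marked)

def Item.origins (σ : Instantiation) : Item → List Origin
  | .seq x => (List.range (σ.seq x).length).map (Origin.seq x)
  | .form m => [Origin.form m]

/-- The origin of the formula occurrence at a position of `S.inst σ`. -/
def SchematicSequent.origin (σ : Instantiation) (S : SchematicSequent) : Occ → Option Origin
  | .left i => (S.ant.flatMap (Item.origins σ))[i]?
  | .right => some (.form S.suc)

/-- `u.Ancestor v`: an occurrence in a premise with origin `v` is an immediate ancestor of an
occurrence in the conclusion with origin `u`. The three cases: principal and auxiliary formula; the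
same formula metavariable; the same position in the same sequence metavariable. -/
def Origin.Ancestor (u v : Origin) : Prop :=
  (∃ φ ψ, u = .form (box φ) ∧ v = .form (box ψ)) ∨
  (∃ (a : FVar) (m m' : Marked), u = .form m ∧ v = .form m' ∧ m.fm = .var a ∧ m'.fm = .var a) ∨
  (∃ x p, u = .seq x p ∧ v = .seq x p)

/-! ### Structural rules -/

/-- The entry is a metavariable (for formulas or for sequences), with no box. -/
def Item.IsMetavariable (t : Item) : Prop :=
  (∃ x, t = .seq x) ∨ (∃ a, t = .form (plain (.var a)))

/-- Only metavariables occur, the succedent is a formula metavariable, and nothing is boxed. -/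
def SchematicSequent.IsStructural (S : SchematicSequent) : Prop :=
  (∀ t ∈ S.ant, t.IsMetavariable) ∧ ∃ a, S.suc = plain (.var a)

def SchematicRule.IsStructural (r : SchematicRule) : Prop :=
  (∀ S ∈ r.premises, S.IsStructural) ∧ r.concl.IsStructural

/-- A linear rule is a structural rule for which the antecedent of the conclusion consists of
pairwise distinct sequence metavariables. -/
def SchematicRule.IsLinear (r : SchematicRule) : Prop :=
  r.IsStructural ∧ ∃ xs : List SVar, xs.Nodup ∧ r.concl.ant = xs.map Item.seq

/-! ### Principal rules

In the rules below `Γ, Δ, Σ` are the sequence metavariables `0, 1, 2`, and the formula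
metavariables are `0, 1` (for `α₀, α₁` or `β₀, β₁` or `α`) and `2` (for an unboxed succedent). -/

/-- `Γ` -/
def sG : Item := .seq 0

/-- `Δ` -/
def sD : Item := .seq 1

/-- `Σ` -/
def sS : Item := .seq 2

/-- The first displayed formula metavariable (`α₀`, `β₀`, `α`). -/
def m0 : Metaformula := .var 0

/-- The second displayed formula metavariable (`α₁`, `β₁`). -/
def m1 : Metaformula := .var 1

/-- The formula metavariable of an unboxed succedent (`β`). -/
def mS : Metaformula := .var 2

/-- A boxed metaformula as an entry of an antecedent. -/
def bx (φ : Metaformula) : Item := .form (box φ)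

def zeroL : SchematicRule := ⟨[], ⟨[sG, bx .zero, sD], plain mS⟩⟩

def oneL : SchematicRule := ⟨[⟨[sG, sD], plain mS⟩], ⟨[sG, bx .one, sD], plain mS⟩⟩

def oneR : SchematicRule := ⟨[], ⟨[], box .one⟩⟩

def meetL0 : SchematicRule :=
  ⟨[⟨[sG, bx m0, sD], plain mS⟩], ⟨[sG, bx (.meet m0 m1), sD], plain mS⟩⟩

def meetL1 : SchematicRule :=
  ⟨[⟨[sG, bx m1, sD], plain mS⟩], ⟨[sG, bx (.meet m0 m1), sD], plain mS⟩⟩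

def meetR : SchematicRule :=
  ⟨[⟨[sG], box m0⟩, ⟨[sG], box m1⟩], ⟨[sG], box (.meet m0 m1)⟩⟩

def joinL : SchematicRule :=
  ⟨[⟨[sG, bx m0, sD], plain mS⟩, ⟨[sG, bx m1, sD], plain mS⟩],
    ⟨[sG, bx (.join m0 m1), sD], plain mS⟩⟩

def joinR0 : SchematicRule := ⟨[⟨[sG], box m0⟩], ⟨[sG], box (.join m0 m1)⟩⟩

def joinR1 : SchematicRule := ⟨[⟨[sG], box m1⟩], ⟨[sG], box (.join m0 m1)⟩⟩

def mulL : SchematicRule :=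
  ⟨[⟨[sG, bx m0, bx m1, sD], plain mS⟩], ⟨[sG, bx (.mul m0 m1), sD], plain mS⟩⟩

def mulR : SchematicRule :=
  ⟨[⟨[sG], box m0⟩, ⟨[sD], box m1⟩], ⟨[sG, sD], box (.mul m0 m1)⟩⟩

def ldivL : SchematicRule :=
  ⟨[⟨[sD], box m0⟩, ⟨[sG, bx m1, sS], plain mS⟩],
    ⟨[sG, sD, bx (.ldiv m0 m1), sS], plain mS⟩⟩

def rdivL : SchematicRule :=
  ⟨[⟨[sD], box m0⟩, ⟨[sG, bx m1, sS], plain mS⟩],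
    ⟨[sG, bx (.rdiv m1 m0), sD, sS], plain mS⟩⟩

def ldivR : SchematicRule := ⟨[⟨[bx m0, sG], box m1⟩], ⟨[sG], box (.ldiv m0 m1)⟩⟩

def rdivR : SchematicRule := ⟨[⟨[sG, bx m0], box m1⟩], ⟨[sG], box (.rdiv m1 m0)⟩⟩

def starR0 : SchematicRule := ⟨[], ⟨[], box (.star m0)⟩⟩

def starR1 : SchematicRule :=
  ⟨[⟨[sG], box m0⟩, ⟨[sD], box (.star m0)⟩], ⟨[sG, sD], box (.star m0)⟩⟩

/-- The rule `*L` of the non-wellfounded systems. -/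
def starLRule : SchematicRule :=
  ⟨[⟨[sG, sD], plain mS⟩, ⟨[sG, bx m0, bx (.star m0), sD], plain mS⟩],
    ⟨[sG, bx (.star m0), sD], plain mS⟩⟩

/-- The conclusion of the `ω`-rule `*L_ω`. -/
def starLOmegaConcl : SchematicSequent := ⟨[sG, bx (.star m0), sD], plain mS⟩

/-- The `n`-th premise of the `ω`-rule `*L_ω`. -/
def starLOmegaPremise (n : ℕ) : SchematicSequent :=
  ⟨[sG] ++ List.replicate n (bx m0) ++ [sD], plain mS⟩

/-- The principal rules other than `*L` and `*L_ω`. -/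
def principalRules : Set SchematicRule :=
  {zeroL, oneL, oneR, meetL0, meetL1, meetR, joinL, joinR0, joinR1, mulL, mulR, ldivL, rdivL,
    ldivR, rdivR, starR0, starR1}

/-! ### Rules and their instances -/

/-- Rules: the identity axiom, the schematic rules, and the `ω`-rule. -/
inductive Rule : Type
  | ident
  | schematic (r : SchematicRule)
  | starLOmega

/-- An instance of a rule, together with the instantiation that gives it. -/
inductive Inference : Type
  | ident (a : PVar)
  | schematic (r : SchematicRule) (σ : Instantiation)
  | starLOmega (σ : Instantiation)

namespace Inference

/-- The rule of which this is an instance. -/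
def rule : Inference → Rule
  | .ident _ => .ident
  | .schematic r _ => .schematic r
  | .starLOmega _ => .starLOmega

/-- The conclusion. -/
def concl : Inference → Sequent
  | .ident a => ⟨[.var a], .var a⟩
  | .schematic r σ => r.concl.inst σ
  | .starLOmega σ => starLOmegaConcl.inst σ

/-- The `n`-th premise, counted from `0`; `none` if there is no such premise. -/
def premise : Inference → ℕ → Option Sequent
  | .ident _, _ => none
  | .schematic r σ, n => r.premises[n]?.map (SchematicSequent.inst σ)
  | .starLOmega σ, n => some ((starLOmegaPremise n).inst σ)

/-- The origin of an occurrence in the conclusion. -/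
def conclOrigin : Inference → Occ → Option Origin
  | .ident _, _ => none
  | .schematic r σ, o => r.concl.origin σ o
  | .starLOmega σ, o => starLOmegaConcl.origin σ o

/-- The origin of an occurrence in the `n`-th premise. -/
def premiseOrigin : Inference → ℕ → Occ → Option Origin
  | .ident _, _, _ => none
  | .schematic r σ, n, o => r.premises[n]?.bind fun S => S.origin σ o
  | .starLOmega σ, n, o => (starLOmegaPremise n).origin σ o

/-- The occurrence `o` in the conclusion is the principal one. -/
def IsPrincipal (ι : Inference) (o : Occ) : Prop :=
  ∃ φ, ι.conclOrigin o = some (.form (box φ))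

/-- The occurrence `o'` in the `n`-th premise is an immediate ancestor of the occurrence `o` in the
conclusion. -/
def IsImmediateAncestor (ι : Inference) (n : ℕ) (o' o : Occ) : Prop :=
  ∃ u v, ι.conclOrigin o = some u ∧ ι.premiseOrigin n o' = some v ∧ u.Ancestor v

end Inference

/-! ### Preproofs -/

/-- A preproof over a set of rules: a possibly non-wellfounded tree of inferences. The nodes are the
`w : List ℕ` with `tree w ≠ none`; the children of `w` are the nodes `w ++ [n]`, and they carry
exactly the premises of the inference at `w`. The sequent at `w` is the conclusion of the inference
at `w`. -/
structure Preproof (𝓡 : Set Rule) where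
  tree : List ℕ → Option Inference
  root_mem : (tree []).isSome
  prefix_closed : ∀ w n, tree w = none → tree (w ++ [n]) = none
  rule_mem : ∀ w ι, tree w = some ι → ι.rule ∈ 𝓡
  children : ∀ w ι, tree w = some ι → ∀ n, (tree (w ++ [n])).map Inference.concl = ι.premise n

namespace Preproof

variable {𝓡 : Set Rule}

/-- `π` is a preproof of `S`: the sequent at the root is `S`. -/
def Proves (π : Preproof 𝓡) (S : Sequent) : Prop :=
  (π.tree []).map Inference.concl = some S

/-- The (infinite) branches: sequences of nodes that start at the root, each a child of the
previous one. -/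
def IsBranch (π : Preproof 𝓡) (b : ℕ → List ℕ) : Prop :=
  b 0 = [] ∧ ∀ i, (π.tree (b i)).isSome ∧ ∃ n, b (i + 1) = b i ++ [n]

/-- `t`, restricted to `I`, is a thread in `(π, b)`. The values of `t` outside `I` are irrelevant. -/
def IsThread (π : Preproof 𝓡) (b : ℕ → List ℕ) (I : Set ℕ) (t : ℕ → Occ) : Prop :=
  I.Nonempty ∧ I.OrdConnected ∧
  (∀ i ∈ I, ∃ ι, π.tree (b i) = some ι ∧ (ι.concl.get (t i)).isSome) ∧
  (∀ i ∈ I, i + 1 ∈ I → ∃ ι n, π.tree (b i) = some ι ∧ b (i + 1) = b i ++ [n] ∧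
    ι.IsImmediateAncestor n (t (i + 1)) (t i))

/-- A `*`-thread: it always denotes the same `*`-formula, in the antecedent. -/
def IsStarThread (π : Preproof 𝓡) (b : ℕ → List ℕ) (I : Set ℕ) (t : ℕ → Occ) : Prop :=
  π.IsThread b I t ∧ ∃ α : Formula, ∀ i ∈ I, t i ≠ .right ∧
    ∃ ι, π.tree (b i) = some ι ∧ ι.concl.get (t i) = some (.star α)

/-- The thread `(I', t')` is a suffix of the thread `(I, t)`. -/
def IsSuffix (I' : Set ℕ) (t' : ℕ → Occ) (I : Set ℕ) (t : ℕ → Occ) : Prop :=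
  I' ⊆ I ∧ (∀ i ∈ I', ∀ j ∈ I, i ≤ j → j ∈ I') ∧ ∀ i ∈ I', t' i = t i

/-- The thread `(I, t)` is progressing: some suffix is a `*`-thread that is principal infinitely
often. -/
def IsProgressingThread (π : Preproof 𝓡) (b : ℕ → List ℕ) (I : Set ℕ) (t : ℕ → Occ) : Prop :=
  π.IsThread b I t ∧ ∃ I' t', IsSuffix I' t' I t ∧ π.IsStarThread b I' t' ∧
    {i ∈ I' | ∃ ι, π.tree (b i) = some ι ∧ ι.IsPrincipal (t' i)}.Infinite

/-- `(π, b)` has a progressing thread. -/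
def IsProgressing (π : Preproof 𝓡) (b : ℕ → List ℕ) : Prop :=
  ∃ I t, π.IsProgressingThread b I t

end Preproof

/-! ### Proof systems -/

/-- A proof system: a set of rules and a condition on the branches of preproofs. -/
structure ProofSystem where
  rules : Set Rule
  branchCondition : Preproof rules → (ℕ → List ℕ) → Prop

/-- There is a proof of `S`: a preproof of `S` all of whose branches satisfy the branch
condition. -/
def ProofSystem.Provable (G : ProofSystem) (S : Sequent) : Prop :=
  ∃ π : Preproof G.rules, π.Proves S ∧ ∀ b, π.IsBranch b → G.branchCondition π b

/-- The wellfounded system plus `R`: identity, the rules in `R`, and all principal rules except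
`*L`. No branch is allowed. -/
def wellfoundedSystem (R : Set SchematicRule) : ProofSystem where
  rules := {.ident, .starLOmega} ∪ Rule.schematic '' (principalRules ∪ R)
  branchCondition _ _ := False

/-- The non-wellfounded system plus `R`: identity, the rules in `R`, and all principal rules except
`*L_ω`. Every branch must have a progressing thread. -/
def nonWellfoundedSystem (R : Set SchematicRule) : ProofSystem where
  rules := {.ident, .schematic starLRule} ∪ Rule.schematic '' (principalRules ∪ R)
  branchCondition π b := π.IsProgressing b

end ActionLat

/-
From wellfounded to non-wellfounded: an instance of `*L_ω` is simulated by an infinite chain of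
instances of `*L`, whose right premises follow one `*`-formula that is always principal. A branch of
the new preproof either stays in such a chain from some point on, and then progresses, or it passes
through infinitely many nodes of the given wellfounded tree, which is impossible.

From non-wellfounded to wellfounded: suppose that a sequent is not provable. Since `*L_ω` reduces
`α*` to the powers `α, …, α`, some replacement of all left `*`-formulas by powers gives a sequent
that is not provable. Linear rules and principal rules other than `*L` survive such replacements,
and `*L` turns into the step from the exponent `k + 1` to `k`, so an unprovable replacement of the
conclusion yields one of some premise, with exponents that do not grow along threads and that drop
at principal `*`-formulas. This defines a branch without a progressing thread.
-/

namespace ActionLat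

open Filter

variable {𝓡 : Set Rule}

/-! ### Building preproofs and following their branches -/

/-- A node of a preproof, bundled with the inference that labels it. -/
structure Preproof.Node (π : Preproof 𝓡) where
  path : List ℕ
  inf : Inference
  tree_path : π.tree path = some inf

namespace Preproof

variable {π : Preproof 𝓡}

/-- `y` is a child of `x`. The smaller node comes first, so that `Acc Node.IsChild x` says that the
subtree at `x` is wellfounded. -/
def Node.IsChild (y x : π.Node) : Prop := ∃ n, y.path = x.path ++ [n]

lemma Node.exists_child (x : π.Node) {n : ℕ} {S : Sequent} (hS : x.inf.premise n = some S) :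
    ∃ y : π.Node, y.path = x.path ++ [n] ∧ y.inf.concl = S := by
  have h := π.children x.path x.inf x.tree_path n
  obtain ⟨ι, hι, hS'⟩ := Option.map_eq_some_iff.1 (h.trans hS)
  exact ⟨⟨_, ι, hι⟩, rfl, hS'⟩

lemma Proves.exists_root {S : Sequent} (h : π.Proves S) :
    ∃ x : π.Node, x.path = [] ∧ x.inf.concl = S := by
  obtain ⟨ι, hι, hS⟩ := Option.map_eq_some_iff.1 h
  exact ⟨⟨[], ι, hι⟩, rfl, hS⟩

lemma isBranch_path {x : ℕ → π.Node} (h0 : (x 0).path = [])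
    (hx : ∀ i, (x (i + 1)).IsChild (x i)) : π.IsBranch fun i => (x i).path :=
  ⟨h0, fun i => ⟨by simp [(x i).tree_path], hx i⟩⟩

lemma Node.acc_of_path_eq_nil (hπ : ∀ b, ¬ π.IsBranch b) {x : π.Node} (hx : x.path = []) :
    Acc Node.IsChild x := by
  by_contra h
  obtain ⟨y, rfl, hy⟩ := not_acc_iff_exists_descending_chain.1 h
  exact hπ _ (isBranch_path hx hy)

end Preproof

/-- Preproofs by corecursion: a system of states, each with an inference and with successor states
for the premises of this inference, unfolds to a preproof. -/
def Preproof.corec {X : Type*} (ι : X → Inference) (next : X → ℕ → Option X)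
    (hι : ∀ x, (ι x).rule ∈ 𝓡)
    (hnext : ∀ x n, (next x n).map (fun y => (ι y).concl) = (ι x).premise n) (x₀ : X) :
    Preproof 𝓡 where
  tree w := (w.foldlM next x₀).map ι
  root_mem := rfl
  prefix_closed w n hw := by
    rw [Option.map_eq_none_iff] at hw
    simp only [List.foldlM_append, hw, Option.bind_eq_bind, Option.bind_none, Option.map_none]
  rule_mem w κ hw := by
    obtain ⟨x, -, rfl⟩ := Option.map_eq_some_iff.1 hw
    exact hι x
  children w κ hw n := by
    obtain ⟨x, hx, rfl⟩ := Option.map_eq_some_iff.1 hw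
    simp only [List.foldlM_append, hx, List.foldlM_cons, List.foldlM_nil, bind_pure,
      Option.bind_eq_bind, Option.bind_some, Option.map_map]
    exact hnext x n

lemma Preproof.IsBranch.exists_states {X : Type*} {ι : X → Inference} {next : X → ℕ → Option X}
    {hι : ∀ x, (ι x).rule ∈ 𝓡}
    {hnext : ∀ x n, (next x n).map (fun y => (ι y).concl) = (ι x).premise n} {x₀ : X}
    {b : ℕ → List ℕ} (hb : (Preproof.corec ι next hι hnext x₀).IsBranch b) :
    ∃ (x : ℕ → X) (f : ℕ → ℕ), x 0 = x₀ ∧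
      ∀ i, (Preproof.corec ι next hι hnext x₀).tree (b i) = some (ι (x i)) ∧
        b (i + 1) = b i ++ [f i] ∧ next (x i) (f i) = some (x (i + 1)) := by
  choose f hf using fun i => (hb.2 i).2
  choose x hx using fun i => Option.isSome_iff_exists.1 (Option.isSome_map.symm.trans (hb.2 i).1)
  refine ⟨x, f, ?_, fun i => ⟨congrArg (Option.map ι) (hx i), hf i, ?_⟩⟩
  · have h0 := hx 0
    rw [hb.1] at h0
    exact (Option.some.inj h0).symm
  · have hsucc := hx (i + 1)
    rw [hf, List.foldlM_append, hx] at hsucc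
    simpa only [List.foldlM_cons, List.foldlM_nil, bind_pure, Option.bind_eq_bind,
      Option.bind_some] using hsucc

theorem exists_preproof_of_forall_premise {X : Type*} {ι : X → Inference}
    (hι : ∀ x, (ι x).rule ∈ 𝓡) {step : X → ℕ → X → Prop}
    (hstep : ∀ x n S, (ι x).premise n = some S → ∃ y, step x n y ∧ (ι y).concl = S) (x₀ : X) :
    ∃ π : Preproof 𝓡, π.Proves (ι x₀).concl ∧ ∀ b, π.IsBranch b → ∃ (x : ℕ → X) (f : ℕ → ℕ),
      x 0 = x₀ ∧ ∀ i, π.tree (b i) = some (ι (x i)) ∧ b (i + 1) = b i ++ [f i] ∧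
        step (x i) (f i) (x (i + 1)) := by
  have hnext (x : X) (n : ℕ) : ∃ o : Option X,
      o.map (fun y => (ι y).concl) = (ι x).premise n ∧ ∀ y, o = some y → step x n y := by
    cases hS : (ι x).premise n with
    | none => exact ⟨none, rfl, nofun⟩
    | some S =>
      obtain ⟨y, hy, rfl⟩ := hstep x n S hS
      exact ⟨some y, rfl, fun _ h => Option.some.inj h ▸ hy⟩
  choose next hconcl hnext using hnext
  refine ⟨Preproof.corec ι next hι hconcl x₀, rfl, fun b hb => ?_⟩
  obtain ⟨x, f, hx0, hx⟩ := hb.exists_states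
  exact ⟨x, f, hx0, fun i => ⟨(hx i).1, (hx i).2.1, hnext _ _ _ (hx i).2.2⟩⟩

/-! ### Progress along a sequence of inferences -/

/-- Progress of a branch with inferences `ι` and directions `f`: from some point on there is a
thread of one and the same left `*`-formula, which is principal infinitely often. -/
def Progresses (ι : ℕ → Inference) (f : ℕ → ℕ) : Prop :=
  ∃ (k : ℕ) (p : ℕ → ℕ) (α : Formula),
    (∀ i ≥ k, (ι i).concl.get (.left (p i)) = some (.star α) ∧
      (ι i).IsImmediateAncestor (f i) (.left (p (i + 1))) (.left (p i))) ∧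
    ∃ᶠ i in atTop, (ι i).IsPrincipal (.left (p i))

section Progress

variable {π : Preproof 𝓡} {b : ℕ → List ℕ} {ι : ℕ → Inference} {f : ℕ → ℕ}

lemma Progresses.isProgressing (h : Progresses ι f) (hι : ∀ i, π.tree (b i) = some (ι i))
    (hf : ∀ i, b (i + 1) = b i ++ [f i]) : π.IsProgressing b := by
  obtain ⟨k, p, α, hthread, hprin⟩ := h
  have ht : π.IsThread b (Set.Ici k) fun i => .left (p i) :=
    ⟨⟨k, Set.self_mem_Ici⟩, Set.ordConnected_Ici,
      fun i hi => ⟨ι i, hι i, by simp [(hthread i hi).1]⟩,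
      fun i hi _ => ⟨ι i, f i, hι i, hf i, (hthread i hi).2⟩⟩
  refine ⟨Set.Ici k, _, ht, Set.Ici k, _, ⟨subset_rfl, fun i hi j _ hij => le_trans hi hij,
    fun _ _ => rfl⟩, ⟨ht, α, fun i hi => ⟨nofun, ι i, hι i, (hthread i hi).1⟩⟩, ?_⟩
  exact (Nat.frequently_atTop_iff_infinite.1 (hprin.and_eventually (eventually_ge_atTop k))).mono
    fun i hi => ⟨hi.2, ι i, hι i, hi.1⟩

lemma Preproof.IsProgressing.progresses (h : π.IsProgressing b)
    (hι : ∀ i, π.tree (b i) = some (ι i)) (hf : ∀ i, b (i + 1) = b i ++ [f i]) :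
    Progresses ι f := by
  obtain ⟨-, -, -, I, t, -, ⟨⟨⟨k, hk⟩, hconn, -, hanc⟩, α, hα⟩, hinf⟩ := h
  have hI (i : ℕ) (hi : k ≤ i) : i ∈ I := by
    obtain ⟨j, hj, hij⟩ := hinf.exists_gt i
    exact hconn.out hk hj.1 ⟨hi, hij.le⟩
  have hleft (i : ℕ) (hi : k ≤ i) : ∃ p, t i = .left p := by
    cases hti : t i with
    | left p => exact ⟨p, rfl⟩
    | right => exact absurd hti (hα i (hI i hi)).1
  choose! p hp using hleft
  refine ⟨k, p, α, fun i hi => ⟨?_, ?_⟩, ?_⟩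
  · obtain ⟨-, κ, hκ, hget⟩ := hα i (hI i hi)
    rw [hι, Option.some.injEq] at hκ
    rwa [hκ, ← hp i hi]
  · obtain ⟨κ, n, hκ, hn, h⟩ := hanc i (hI i hi) (hI (i + 1) (by omega))
    rw [hι, Option.some.injEq] at hκ
    obtain rfl : f i = n := by simpa using (hf i).symm.trans hn
    rwa [hκ, ← hp i hi, ← hp (i + 1) (by omega)]
  · refine Nat.frequently_atTop_iff_infinite.2 ((hinf.sdiff (Set.finite_lt_nat k)).mono ?_)
    rintro i ⟨⟨-, κ, hκ, hprin⟩, hi⟩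
    rw [hι, Option.some.injEq] at hκ
    rw [Set.mem_ofPred_eq, hκ, ← hp i (not_lt.1 hi)]
    exact hprin

end Progress

/-! ### From wellfounded to non-wellfounded proofs -/

lemma exists_forall_ge_not_rel_of_acc {X : Type*} {r : X → X → Prop} {x : ℕ → X} {m : ℕ}
    (hm : Acc r (x m)) (hx : ∀ i, r (x (i + 1)) (x i) ∨ x (i + 1) = x i) :
    ∃ k, ∀ i ≥ k, ¬ r (x (i + 1)) (x i) := by
  generalize hy : x m = y at hm
  induction hm generalizing m with
  | intro y _ ih =>
    subst hy
    by_cases hdesc : ∃ i ≥ m, r (x (i + 1)) (x i) ∧ x i = x m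
    · obtain ⟨i, -, hr, hi⟩ := hdesc
      exact ih _ (hi ▸ hr) rfl
    · have hconst : ∀ i ≥ m, x i = x m := fun i hi => by
        induction i, hi using Nat.le_induction with
        | base => rfl
        | succ i hi ih => exact ((hx i).resolve_left fun hr => hdesc ⟨i, hi, hr, ih⟩).trans ih
      exact ⟨m, fun i hi hr => hdesc ⟨i, hi, hr, hconst i hi⟩⟩

/-- The instantiation in which `Γ, α, …, α`, with `k` copies of `α`, takes the place of `Γ`. -/
def Instantiation.appendCopies (σ : Instantiation) (k : ℕ) : Instantiation :=
  ⟨σ.form, Function.update σ.seq 0 (σ.seq 0 ++ List.replicate k (σ.form 0))⟩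

/-- The `k`-th inference of the infinite chain of instances of `*L` that simulates an instance
of `*L_ω`; any other inference is kept. -/
def unfoldInference : Inference → ℕ → Inference
  | .starLOmega σ, k => .schematic starLRule (σ.appendCopies k)
  | ι, _ => ι

section AppendCopies

variable (σ : Instantiation) (k : ℕ)

lemma starLRule_concl_inst : starLRule.concl.inst σ =
    ⟨σ.seq 0 ++ .star (σ.form 0) :: σ.seq 1, σ.form 2⟩ := by
  simp [starLRule, SchematicSequent.inst, Item.inst, sG, sD, bx, box, plain, m0, mS, Term.subst]

lemma starLRule_premise_zero : (Inference.schematic starLRule σ).premise 0 =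
    some ⟨σ.seq 0 ++ σ.seq 1, σ.form 2⟩ := by
  simp [Inference.premise, starLRule, SchematicSequent.inst, Item.inst, sG, sD, plain, mS,
    Term.subst]

lemma starLRule_premise_one : (Inference.schematic starLRule σ).premise 1 =
    some ⟨σ.seq 0 ++ σ.form 0 :: .star (σ.form 0) :: σ.seq 1, σ.form 2⟩ := by
  simp [Inference.premise, starLRule, SchematicSequent.inst, Item.inst, sG, sD, bx, box, plain, m0,
    mS, Term.subst]

lemma starLOmegaPremise_inst (n : ℕ) : (starLOmegaPremise n).inst σ =
    ⟨σ.seq 0 ++ List.replicate n (σ.form 0) ++ σ.seq 1, σ.form 2⟩ := by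
  simp [starLOmegaPremise, SchematicSequent.inst, Item.inst, sG, sD, bx, box, plain, m0, mS,
    Term.subst, List.flatMap_replicate, List.flatten_replicate_singleton]

lemma unfoldInference_zero_concl (ι : Inference) : (unfoldInference ι 0).concl = ι.concl := by
  cases ι with
  | starLOmega σ =>
    refine (starLRule_concl_inst _).trans (Eq.trans ?_ (starLRule_concl_inst σ).symm)
    simp [Instantiation.appendCopies]
  | _ => rfl

lemma appendCopies_premise_zero :
    (Inference.schematic starLRule (σ.appendCopies k)).premise 0 =
      some ((starLOmegaPremise k).inst σ) := by
  simp [starLRule_premise_zero, starLOmegaPremise_inst, Instantiation.appendCopies]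

lemma appendCopies_premise_one :
    (Inference.schematic starLRule (σ.appendCopies k)).premise 1 =
      some (starLRule.concl.inst (σ.appendCopies (k + 1))) := by
  simp [starLRule_premise_one, starLRule_concl_inst, Instantiation.appendCopies,
    List.replicate_succ']

lemma conclOrigin_starLRule : (Inference.schematic starLRule σ).conclOrigin
    (.left (σ.seq 0).length) = some (.form (box (.star m0))) := by
  simp [Inference.conclOrigin, SchematicSequent.origin, starLRule, sG, sD, bx, Item.origins]

lemma isImmediateAncestor_starLRule : (Inference.schematic starLRule σ).IsImmediateAncestor 1
    (.left ((σ.seq 0).length + 1)) (.left (σ.seq 0).length) := by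
  refine ⟨_, .form (box (.star m0)), conclOrigin_starLRule σ, ?_, .inl ⟨_, _, rfl, rfl⟩⟩
  simp [Inference.premiseOrigin, SchematicSequent.origin, starLRule, sG, sD, bx, Item.origins]

lemma progresses_appendCopies {ι : ℕ → Inference} {f l : ℕ → ℕ} {m : ℕ}
    (hι : ∀ i ≥ m, ι i = .schematic starLRule (σ.appendCopies (l i)))
    (hl : ∀ i ≥ m, l (i + 1) = l i + 1) (hf : ∀ i ≥ m, f i = 1) : Progresses ι f := by
  have hlen (j : ℕ) : ((σ.appendCopies j).seq 0).length = (σ.seq 0).length + j := by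
    simp [Instantiation.appendCopies]
  refine ⟨m, fun i => ((σ.appendCopies (l i)).seq 0).length, σ.form 0, fun i hi => ⟨?_, ?_⟩, ?_⟩
  · rw [hι i hi]
    simp [Inference.concl, starLRule_concl_inst, Sequent.get, Instantiation.appendCopies]
  · simpa only [hι i hi, hf i hi, hl i hi, hlen, add_assoc] using
      isImmediateAncestor_starLRule (σ.appendCopies (l i))
  · refine ((eventually_ge_atTop m).mono fun i hi => ⟨.star m0, ?_⟩).frequently
    rw [hι i hi, conclOrigin_starLRule]

end AppendCopies

/-- The steps of the unfolding of a preproof whose states are a node and a number of copies: either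
go to a child, or stay at an instance of `*L_ω` and append one more copy. -/
def UnfoldStep {π : Preproof 𝓡} (x : π.Node × ℕ) (n : ℕ) (y : π.Node × ℕ) : Prop :=
  y.1.IsChild x.1 ∨ y.1 = x.1 ∧ y.2 = x.2 + 1 ∧ n = 1 ∧ ∃ σ, x.1.inf = .starLOmega σ

lemma exists_unfoldStep {π : Preproof 𝓡} (x : π.Node × ℕ) {n : ℕ} {S : Sequent}
    (hS : (unfoldInference x.1.inf x.2).premise n = some S) :
    ∃ y, UnfoldStep x n y ∧ (unfoldInference y.1.inf y.2).concl = S := by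
  obtain ⟨x, k⟩ := x
  have exists_step {j : ℕ} (hj : x.inf.premise j = some S) :
      ∃ y, UnfoldStep (x, k) n y ∧ (unfoldInference y.1.inf y.2).concl = S := by
    obtain ⟨y, hy, rfl⟩ := x.exists_child hj
    exact ⟨(y, 0), .inl ⟨j, hy⟩, unfoldInference_zero_concl _⟩
  cases hx : x.inf with
  | starLOmega σ =>
    simp only [hx, unfoldInference] at hS
    match n with
    | 0 =>
      rw [appendCopies_premise_zero] at hS
      exact exists_step (j := k) (by rw [hx]; exact hS)
    | 1 =>
      rw [appendCopies_premise_one, Option.some.injEq] at hS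
      exact ⟨(x, k + 1), .inr ⟨rfl, rfl, rfl, σ, hx⟩, by rw [hx]; exact hS⟩
    | n + 2 => simp [Inference.premise, starLRule] at hS
  | _ =>
    simp only [hx, unfoldInference] at hS
    exact exists_step (by rw [hx]; exact hS)

lemma unfoldInference_rule_mem {R : Set SchematicRule} {ι : Inference}
    (hι : ι.rule ∈ (wellfoundedSystem R).rules) (k : ℕ) :
    (unfoldInference ι k).rule ∈ (nonWellfoundedSystem R).rules := by
  cases ι <;>
    simp_all [unfoldInference, Inference.rule, wellfoundedSystem, nonWellfoundedSystem]

theorem ProofSystem.Provable.nonWellfounded {R : Set SchematicRule} {S : Sequent}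
    (h : (wellfoundedSystem R).Provable S) : (nonWellfoundedSystem R).Provable S := by
  obtain ⟨π, hπ, hbranch⟩ := h
  obtain ⟨x₀, hx₀, rfl⟩ := hπ.exists_root
  obtain ⟨ρ, hρ, hrun⟩ := exists_preproof_of_forall_premise
    (ι := fun x : π.Node × ℕ => unfoldInference x.1.inf x.2)
    (fun x => unfoldInference_rule_mem (π.rule_mem _ _ x.1.tree_path) x.2)
    (fun x _ _ => exists_unfoldStep x) (x₀, 0)
  refine ⟨ρ, hρ.trans (congrArg some (unfoldInference_zero_concl _)), fun b hb => ?_⟩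
  obtain ⟨x, f, hx0, hx⟩ := hrun b hb
  have hacc : Acc Preproof.Node.IsChild (x 0).1 :=
    Preproof.Node.acc_of_path_eq_nil hbranch (by rw [hx0, hx₀])
  obtain ⟨m, hm⟩ := exists_forall_ge_not_rel_of_acc hacc fun i => (hx i).2.2.imp_right And.left
  have hstay (i : ℕ) (hi : i ≥ m) := (hx i).2.2.resolve_left (hm i hi)
  obtain ⟨-, -, -, σ, hσ⟩ := hstay m le_rfl
  have hinf : ∀ i ≥ m, (x i).1.inf = .starLOmega σ := fun i hi => by
    induction i, hi using Nat.le_induction with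
    | base => exact hσ
    | succ i hi ih => rw [(hstay i hi).1, ih]
  refine Progresses.isProgressing (progresses_appendCopies σ (l := fun i => (x i).2)
    (fun i hi => ?_) (fun i hi => (hstay i hi).2.1) fun i hi => (hstay i hi).2.2.1)
    (fun i => (hx i).1) fun i => (hx i).2.1
  rw [hinf i hi]
  rfl

/-! ### Predicates closed under rules -/

/-- `P` is closed under all instances of the rules in `𝓡`, including those of the `ω`-rule. -/
def ClosedUnder (𝓡 : Set Rule) (P : Sequent → Prop) : Prop :=
  ∀ ι : Inference, ι.rule ∈ 𝓡 → (∀ n S, ι.premise n = some S → P S) → P ι.concl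

/-- The states of the proof assembled from an inference and from preproofs of its premises: `none`
is the root, and the other states are the nodes of all preproofs. -/
abbrev GraftState (𝓡 : Set Rule) : Type := Option (Σ π : Preproof 𝓡, π.Node)

/-- The steps of this proof: the root leads to any wellfounded node, and a node to its children. -/
inductive GraftStep : GraftState 𝓡 → GraftState 𝓡 → Prop
  | root {π : Preproof 𝓡} {x : π.Node} (hx : Acc Preproof.Node.IsChild x) :
      GraftStep none (some ⟨π, x⟩)
  | child {π : Preproof 𝓡} {x y : π.Node} (hyx : y.IsChild x) :
      GraftStep (some ⟨π, x⟩) (some ⟨π, y⟩)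

lemma acc_graftStep_some {π : Preproof 𝓡} {x : π.Node} (hx : Acc Preproof.Node.IsChild x) :
    Acc (Function.swap GraftStep) (some ⟨π, x⟩) := by
  induction hx with
  | intro x _ ih => exact ⟨_, by rintro _ (_ | hyx); exact ih _ hyx⟩

lemma acc_graftStep_none : Acc (Function.swap GraftStep) (none : GraftState 𝓡) :=
  ⟨_, by rintro _ (hx | _); exact acc_graftStep_some hx⟩

theorem closedUnder_exists_preproof_forall_not_isBranch : ClosedUnder 𝓡 fun S =>
    ∃ π : Preproof 𝓡, π.Proves S ∧ ∀ b, ¬ π.IsBranch b := by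
  intro ι hι hprem
  let inf : GraftState 𝓡 → Inference := fun x => x.elim ι fun x => x.2.inf
  have hinf : ∀ x, (inf x).rule ∈ 𝓡
    | none => hι
    | some ⟨π, x⟩ => π.rule_mem _ _ x.tree_path
  have hstep : ∀ x n S, (inf x).premise n = some S → ∃ y, GraftStep x y ∧ (inf y).concl = S
    | none, n, S, hS => by
      obtain ⟨π, hπ, hbranch⟩ := hprem n S hS
      obtain ⟨y, hy, rfl⟩ := hπ.exists_root
      exact ⟨some ⟨π, y⟩, .root (Preproof.Node.acc_of_path_eq_nil hbranch hy), rfl⟩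
    | some ⟨π, x⟩, n, S, hS => by
      obtain ⟨y, hy, rfl⟩ := x.exists_child hS
      exact ⟨some ⟨π, y⟩, .child ⟨n, hy⟩, rfl⟩
  obtain ⟨ρ, hρ, hrun⟩ :=
    exists_preproof_of_forall_premise hinf (step := fun x _ y => GraftStep x y) hstep none
  refine ⟨ρ, hρ, fun b hb => ?_⟩
  obtain ⟨x, f, hx0, hx⟩ := hrun b hb
  exact not_acc_iff_exists_descending_chain.2 ⟨x, hx0, fun i => (hx i).2.2⟩ acc_graftStep_none

/-! ### Replacing `*`-formulas by powers -/

/-- Replace `α*` by the sequence `α, …, α` of the given length; other formulas are kept. -/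
def starPower : Formula → Option ℕ → List Formula
  | .star α, some n => List.replicate n α
  | φ, _ => [φ]

@[simp] lemma starPower_none (φ : Formula) : starPower φ none = [φ] := by
  cases φ <;> rfl

@[simp] lemma starPower_star (α : Formula) (n : ℕ) :
    starPower (.star α) (some n) = List.replicate n α := rfl

lemma starPower_of_ne {φ : Formula} (h : ∀ α, φ ≠ .star α) (o : Option ℕ) :
    starPower φ o = [φ] := by
  cases φ <;> first | rfl | exact absurd rfl (h _)

/-- Replace the `*`-formulas `α*` of a sequence by powers of `α`, with an exponent depending on the
position; the label `none` keeps the formula. -/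
def expand (p : ℕ → Option ℕ) (Γ : List Formula) : List Formula :=
  (Γ.mapIdx fun i φ => starPower φ (p i)).flatten

section Expand

variable {p q : ℕ → Option ℕ} {Γ Δ : List Formula}

@[simp] lemma expand_nil : expand p [] = [] := rfl

@[simp] lemma expand_cons (φ : Formula) : expand p (φ :: Γ) =
    starPower φ (p 0) ++ expand (fun i => p (i + 1)) Γ := by
  simp only [expand, List.mapIdx_cons, List.flatten_cons]

lemma expand_append :
    expand p (Γ ++ Δ) = expand p Γ ++ expand (fun i => p (i + Γ.length)) Δ := by
  simp only [expand, List.mapIdx_append, List.flatten_append]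

lemma expand_congr (h : ∀ i φ, Γ[i]? = some φ → starPower φ (p i) = starPower φ (q i)) :
    expand p Γ = expand q Γ := by
  refine congrArg List.flatten (List.mapIdx_eq_mapIdx_iff.2 fun i hi => h i _ ?_)
  exact List.getElem?_eq_getElem hi

lemma expand_none : expand (fun _ => none) Γ = Γ := by
  induction Γ with
  | nil => rfl
  | cons φ Γ ih => simp only [expand_cons, starPower_none, ih, List.singleton_append]

end Expand

/-- Replace the left `*`-formulas of a sequent by powers. -/
def Sequent.expand (p : ℕ → Option ℕ) (S : Sequent) : Sequent :=
  ⟨ActionLat.expand p S.ant, S.suc⟩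

section ClosedUnder

variable {P : Sequent → Prop} {Γ Δ : List Formula} {β : Formula}

lemma ClosedUnder.star_left (hP : ClosedUnder 𝓡 P) (hω : Rule.starLOmega ∈ 𝓡) {α : Formula}
    (h : ∀ n, P ⟨Γ ++ List.replicate n α ++ Δ, β⟩) : P ⟨Γ ++ [.star α] ++ Δ, β⟩ := by
  let σ : Instantiation :=
    ⟨fun v => if v = 0 then α else β, fun x => if x = 0 then Γ else Δ⟩
  have := hP (.starLOmega σ) hω fun n S hS => by
    rw [Inference.premise, Option.some.injEq, starLOmegaPremise_inst] at hS
    exact hS ▸ h n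
  rw [List.append_assoc, List.singleton_append]
  exact (starLRule_concl_inst σ) ▸ this

lemma ClosedUnder.of_starPower (hP : ClosedUnder 𝓡 P) (hω : Rule.starLOmega ∈ 𝓡) {φ : Formula}
    {o : Option ℕ} (h : ∀ n, (∀ m, o = some m → n = m) → P ⟨Γ ++ starPower φ (some n) ++ Δ, β⟩) :
    P ⟨Γ ++ starPower φ o ++ Δ, β⟩ := by
  cases o with
  | some n => exact h n (by simp)
  | none =>
    by_cases hφ : ∃ α, φ = .star α
    · obtain ⟨α, rfl⟩ := hφ
      exact hP.star_left hω fun n => h n (by simp)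
    · have hφ' := starPower_of_ne (not_exists.1 hφ)
      simpa only [hφ'] using h 0 (by simp)

lemma ClosedUnder.of_expand_append (hP : ClosedUnder 𝓡 P) (hω : Rule.starLOmega ∈ 𝓡)
    {p : ℕ → Option ℕ} {Θ : List Formula}
    (h : ∀ a : ℕ → ℕ, (∀ i n, p i = some n → a i = n) →
      P ⟨Γ ++ expand (fun i => some (a i)) Θ ++ Δ, β⟩) :
    P ⟨Γ ++ expand p Θ ++ Δ, β⟩ := by
  induction Θ generalizing p Γ with
  | nil => exact h (fun i => (p i).getD 0) fun i n hi => by simp [hi]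
  | cons φ Θ ih =>
    rw [expand_cons, ← List.append_assoc, List.append_assoc]
    refine hP.of_starPower hω fun n hn => ?_
    rw [← List.append_assoc]
    refine ih fun a ha => ?_
    have := h (fun i => i.casesOn n a) fun i m hi => by
      cases i with
      | zero => exact hn m hi
      | succ i => exact ha i m hi
    rwa [expand_cons, ← List.append_assoc] at this

/-- Iterated use of `*L_ω`: it suffices to treat the total refinements of a partial replacement. -/
lemma ClosedUnder.of_expand (hP : ClosedUnder 𝓡 P) (hω : Rule.starLOmega ∈ 𝓡) {S : Sequent}
    {p : ℕ → Option ℕ}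
    (h : ∀ a : ℕ → ℕ, (∀ i n, p i = some n → a i = n) → P (S.expand fun i => some (a i))) :
    P (S.expand p) := by
  have := hP.of_expand_append (Γ := []) (Δ := []) (Θ := S.ant) (β := S.suc) (p := p) hω
  simp only [List.nil_append, List.append_nil] at this
  exact this h

end ClosedUnder

/-! ### Replacements in instances of schematic sequents -/

/-- The formula denoted by an origin. -/
def Origin.formula (σ : Instantiation) : Origin → Option Formula
  | .seq x p => (σ.seq x)[p]?
  | .form m => some (m.fm.subst σ.form)

/-- Labels for origins, from labels for the positions in the sequence metavariables and for the
displayed metaformulas. -/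
def originLabel (c : SVar → ℕ → ℕ) (d : Marked → Option ℕ) : Origin → Option ℕ
  | .seq x p => some (c x p)
  | .form m => d m

/-- The instance of an item in which the `*`-formulas are replaced by powers, with the exponents
given by labels of the origins. -/
def Item.expandInst (σ : Instantiation) (l : Origin → Option ℕ) : Item → List Formula
  | .seq x => expand (fun p => l (.seq x p)) (σ.seq x)
  | .form m => starPower (m.fm.subst σ.form) (l (.form m))

/-- The instance of a schematic sequent in which the left `*`-formulas are replaced by powers, with
the exponents given by labels of the origins. -/
def SchematicSequent.expandInst (σ : Instantiation) (l : Origin → Option ℕ)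
    (S : SchematicSequent) : Sequent :=
  ⟨S.ant.flatMap (Item.expandInst σ l), S.suc.fm.subst σ.form⟩

/-- The instantiation with the `*`-formulas in the sequence metavariables replaced by powers. -/
def Instantiation.expand (σ : Instantiation) (c : SVar → ℕ → ℕ) : Instantiation :=
  ⟨σ.form, fun x => ActionLat.expand (fun p => some (c x p)) (σ.seq x)⟩

lemma Item.length_origins (σ : Instantiation) (t : Item) :
    (t.origins σ).length = (t.inst σ).length := by
  cases t <;> simp [Item.origins, Item.inst]

lemma Item.map_formula_origins (σ : Instantiation) (t : Item) :
    (t.origins σ).map (Origin.formula σ) = (t.inst σ).map some := by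
  cases t with
  | seq x =>
    refine List.ext_getElem (by simp [Item.origins, Item.inst]) fun i hi _ => ?_
    simp [Item.origins, Item.inst, Origin.formula]
  | form m => rfl

lemma flatMap_expandInst (σ : Instantiation) (l : Origin → Option ℕ) (T : List Item) :
    T.flatMap (Item.expandInst σ l) =
      expand (fun i => (T.flatMap (Item.origins σ))[i]?.bind l) (T.flatMap (Item.inst σ)) := by
  induction T with
  | nil => rfl
  | cons t T ih =>
    simp only [List.flatMap_cons, expand_append, ih]
    congr 1
    · cases t with
      | seq x =>
        refine expand_congr fun i φ hi => ?_
        have hi' : i < (σ.seq x).length := (List.getElem?_eq_some_iff.1 hi).1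
        rw [List.getElem?_append_left (by simpa [Item.origins] using hi')]
        simp [Item.origins, hi']
      | form m => simp [Item.expandInst, Item.inst, Item.origins]
    · simp only [← Item.length_origins, List.getElem?_append_right (Nat.le_add_left _ _),
        Nat.add_sub_cancel]

namespace SchematicSequent

variable {S : SchematicSequent} {σ : Instantiation}

lemma expand_inst (l : Origin → Option ℕ) :
    (S.inst σ).expand (fun i => (S.origin σ (.left i)).bind l) = S.expandInst σ l := by
  rw [expandInst, flatMap_expandInst]
  rfl

lemma expandInst_originLabel_none (c : SVar → ℕ → ℕ) :
    S.expandInst σ (originLabel c fun _ => none) = S.inst (σ.expand c) := by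
  refine congrArg (Sequent.mk · _) (congrArg S.ant.flatMap (funext fun t => ?_))
  cases t <;> simp [Item.expandInst, Item.inst, originLabel, Instantiation.expand]

lemma get_inst (o : Occ) : (S.inst σ).get o = (S.origin σ o).bind (Origin.formula σ) := by
  cases o with
  | right => rfl
  | left i =>
    have h : (S.ant.flatMap (Item.origins σ)).map (Origin.formula σ) =
        (S.inst σ).ant.map some := by
      simp only [inst, List.map_flatMap, Item.map_formula_origins]
    have hi := congrArg (·[i]?) h
    simp only [List.getElem?_map] at hi
    simp only [Sequent.get, origin]
    cases hS : (S.inst σ).ant[i]? <;> cases hO : (S.ant.flatMap (Item.origins σ))[i]? <;>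
      simp_all

lemma form_mem_of_origin_eq {i : ℕ} {m : Marked} (h : S.origin σ (.left i) = some (.form m)) :
    Item.form m ∈ S.ant := by
  obtain ⟨t, ht, hm⟩ := List.mem_flatMap.1 (List.mem_of_getElem? h)
  cases t with
  | seq x => simp [Item.origins] at hm
  | form m' =>
    obtain rfl : m = m' := by simpa [Item.origins] using hm
    exact ht

/-- The occurrences of sequence metavariables in the antecedent are pairwise distinct. -/
def IsSeqLinear (S : SchematicSequent) : Prop :=
  S.ant.Pairwise fun s t => ∀ x, s = .seq x → t ≠ .seq x

lemma IsSeqLinear.origin_injective (hS : S.IsSeqLinear) {i j : ℕ} {x : SVar} {p : ℕ}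
    (hi : S.origin σ (.left i) = some (.seq x p)) (hj : S.origin σ (.left j) = some (.seq x p)) :
    i = j := by
  have h : (S.ant.flatMap (Item.origins σ)).Pairwise
      fun u v => ∀ x p, u = .seq x p → v ≠ .seq x p := by
    refine List.pairwise_flatMap.2 ⟨fun t _ => ?_, hS.imp fun {s t} hst => ?_⟩
    · cases t with
      | seq x =>
        refine List.pairwise_map.2 (List.pairwise_lt_range.imp fun {p q} hpq y r => ?_)
        rintro ⟨⟩ ⟨⟩
        exact hpq.ne rfl
      | form m => exact List.pairwise_singleton _ _
    · cases s <;> cases t <;> simp_all [Item.origins]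
  obtain ⟨hi', hi⟩ := List.getElem?_eq_some_iff.1 hi
  obtain ⟨hj', hj⟩ := List.getElem?_eq_some_iff.1 hj
  rw [List.pairwise_iff_getElem] at h
  rcases lt_trichotomy i j with hij | hij | hij
  · exact absurd hj (h i j hi' hj' hij x p hi)
  · exact hij
  · exact absurd hi (h j i hj' hi' hij x p hj)

lemma IsSeqLinear.exists_seqLabel (hS : S.IsSeqLinear) (σ : Instantiation) (a : ℕ → ℕ) :
    ∃ c : SVar → ℕ → ℕ, ∀ i x p, S.origin σ (.left i) = some (.seq x p) → c x p = a i := by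
  have h (x p : ℕ) : ∃ n, ∀ i, S.origin σ (.left i) = some (.seq x p) → n = a i := by
    by_cases hx : ∃ i, S.origin σ (.left i) = some (.seq x p)
    · obtain ⟨i, hi⟩ := hx
      exact ⟨a i, fun j hj => congrArg a (hS.origin_injective hi hj)⟩
    · exact ⟨0, fun i hi => absurd ⟨i, hi⟩ hx⟩
  choose c hc using h
  exact ⟨c, fun i x p => hc x p i⟩

/-- The replacement of left `*`-formulas by powers turns every instance of the schematic sequent
into another instance: it affects the sequence metavariables only, and each of them only once. -/
structure IsStarStable (S : SchematicSequent) : Prop where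
  isSeqLinear : S.IsSeqLinear
  subst_ne_star : ∀ m, Item.form m ∈ S.ant → ∀ (σ : FVar → Formula) α, m.fm.subst σ ≠ .star α

lemma expand_inst_eq_expandInst {a : ℕ → ℕ} {l : Origin → Option ℕ}
    (h : ∀ i u φ, S.origin σ (.left i) = some u → u.formula σ = some φ →
      starPower φ (some (a i)) = starPower φ (l u)) :
    (S.inst σ).expand (fun i => some (a i)) = S.expandInst σ l := by
  rw [← expand_inst]
  refine congrArg (Sequent.mk · _) (expand_congr fun i φ hi => ?_)
  obtain ⟨u, hu, hφ⟩ := Option.bind_eq_some_iff.1 ((S.get_inst (.left i)).symm.trans hi)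
  rw [hu, Option.bind_some, h i u φ hu hφ]

lemma IsStarStable.expand_inst (hS : S.IsStarStable) {a : ℕ → ℕ} {c : SVar → ℕ → ℕ}
    (hc : ∀ i x p, S.origin σ (.left i) = some (.seq x p) → c x p = a i) :
    (S.inst σ).expand (fun i => some (a i)) = S.inst (σ.expand c) := by
  rw [← expandInst_originLabel_none]
  refine expand_inst_eq_expandInst fun i u φ hu hφ => ?_
  cases u with
  | seq x p => rw [originLabel, hc i x p hu]
  | form m =>
    obtain rfl : m.fm.subst σ.form = φ := Option.some.inj hφ
    simp only [starPower_of_ne (hS.subst_ne_star m (form_mem_of_origin_eq hu) σ.form)]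

end SchematicSequent

lemma isStarStable_of_mem_principalRules {r : SchematicRule} (hr : r ∈ principalRules) :
    r.concl.IsStarStable := by
  simp only [principalRules, Set.mem_insert_iff, Set.mem_singleton_iff] at hr
  constructor <;>
  rcases hr with rfl | rfl | rfl | rfl | rfl | rfl | rfl | rfl | rfl | rfl | rfl | rfl | rfl |
      rfl | rfl | rfl | rfl <;>
    simp [SchematicSequent.IsSeqLinear, zeroL, oneL, oneR, meetL0, meetL1, meetR, joinL, joinR0,
      joinR1, mulL, mulR, ldivL, rdivL, ldivR, rdivR, starR0, starR1, sG, sD, sS, bx, box,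
      Term.subst]

lemma SchematicRule.IsLinear.isStarStable {r : SchematicRule} (hr : r.IsLinear) :
    r.concl.IsStarStable := by
  obtain ⟨-, xs, hxs, h⟩ := hr
  constructor
  · rw [SchematicSequent.IsSeqLinear, h, List.pairwise_map]
    exact hxs.imp fun hxy z hx hy => hxy (Item.seq.inj (hx.trans hy.symm))
  · simp [h]

/-! ### From non-wellfounded proofs to closed predicates -/

/-- Labels of left positions decrease along left threads of one and the same `*`-formula, from the
conclusion of `ι` to its `n`-th premise `S`, and strictly so where this formula is principal. -/
def Inference.Decreases (ι : Inference) (n : ℕ) (S : Sequent) (a a' : ℕ → ℕ) : Prop :=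
  ∀ i j α, ι.concl.get (.left i) = some (.star α) → S.get (.left j) = some (.star α) →
    ι.IsImmediateAncestor n (.left j) (.left i) →
    a' j ≤ a i ∧ (ι.IsPrincipal (.left i) → a' j < a i)

/-- Some premise of `ι` is refuted by labels for which the labels `a` decrease. -/
def Inference.HasRefutedPremise (P : Sequent → Prop) (ι : Inference) (a : ℕ → ℕ) : Prop :=
  ∃ n S a', ι.premise n = some S ∧ ¬ P (S.expand fun i => some (a' i)) ∧ ι.Decreases n S a a'

section Refutation

variable {P : Sequent → Prop} {r : SchematicRule} {σ : Instantiation} {n : ℕ}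
  {T : SchematicSequent} {a a' : ℕ → ℕ} {c : SVar → ℕ → ℕ} {d : Marked → Option ℕ}

lemma decreases_of_label (hT : r.premises[n]? = some T)
    (hc : ∀ i x p, r.concl.origin σ (.left i) = some (.seq x p) → c x p = a i)
    (ha' : ∀ j m, (T.origin σ (.left j)).bind (originLabel c d) = some m → a' j = m)
    (hform : ∀ i j m m' α, r.concl.origin σ (.left i) = some (.form m) →
      T.origin σ (.left j) = some (.form m') → m.fm.subst σ.form = .star α →
      m'.fm.subst σ.form = .star α → a' j < a i) :
    (Inference.schematic r σ).Decreases n (T.inst σ) a a' := by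
  rintro i j α hi hj ⟨u, v, hu, hv, huv⟩
  change r.concl.origin σ (.left i) = some u at hu
  rw [Inference.premiseOrigin, hT, Option.bind_some] at hv
  change (r.concl.inst σ).get (.left i) = _ at hi
  rw [SchematicSequent.get_inst, hu, Option.bind_some] at hi
  rw [SchematicSequent.get_inst, hv, Option.bind_some] at hj
  have lt_of_form (m m') (hm : u = .form m) (hm' : v = .form m') : a' j < a i := by
    subst hm hm'
    exact hform i j m m' α hu hv (Option.some.inj hi) (Option.some.inj hj)
  rcases huv with ⟨φ, ψ, hm, hm'⟩ | ⟨b, m, m', hm, hm', -⟩ | ⟨x, p, rfl, rfl⟩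
  · exact ⟨(lt_of_form _ _ hm hm').le, fun _ => lt_of_form _ _ hm hm'⟩
  · exact ⟨(lt_of_form _ _ hm hm').le, fun _ => lt_of_form _ _ hm hm'⟩
  · have : a' j = a i := ha' j _ (by rw [hv, Option.bind_some, originLabel, hc i x p hu])
    refine ⟨this.le, fun ⟨φ, hφ⟩ => ?_⟩
    simpa using hu.symm.trans hφ

lemma ClosedUnder.hasRefutedPremise_of_expandInst (hP : ClosedUnder 𝓡 P)
    (hω : Rule.starLOmega ∈ 𝓡) (hT : r.premises[n]? = some T)
    (h : ¬ P (T.expandInst σ (originLabel c d)))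
    (hc : ∀ i x p, r.concl.origin σ (.left i) = some (.seq x p) → c x p = a i)
    (hform : ∀ i m m' α, r.concl.origin σ (.left i) = some (.form m) →
      Item.form m' ∈ T.ant → m.fm.subst σ.form = .star α → m'.fm.subst σ.form = .star α →
      ∃ k < a i, d m' = some k) :
    (Inference.schematic r σ).HasRefutedPremise P a := by
  rw [← SchematicSequent.expand_inst] at h
  obtain ⟨a', ha', hnot⟩ : ∃ a' : ℕ → ℕ, (∀ j m, (T.origin σ (.left j)).bind (originLabel c d) =
      some m → a' j = m) ∧ ¬ P ((T.inst σ).expand fun j => some (a' j)) := by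
    by_contra! hall
    exact h (hP.of_expand hω hall)
  refine ⟨n, T.inst σ, a', by rw [Inference.premise, hT, Option.map_some], hnot,
    decreases_of_label hT hc ha' fun i j m m' α hi hj hm hm' => ?_⟩
  obtain ⟨k, hk, hd⟩ := hform i m m' α hi (SchematicSequent.form_mem_of_origin_eq hj) hm hm'
  rwa [ha' j k (by rw [hj, Option.bind_some, originLabel, hd])]

lemma ClosedUnder.hasRefutedPremise_of_isStarStable (hP : ClosedUnder 𝓡 P)
    (hω : Rule.starLOmega ∈ 𝓡) (hr : .schematic r ∈ 𝓡) (hS : r.concl.IsStarStable)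
    (ha : ¬ P ((r.concl.inst σ).expand fun i => some (a i))) :
    (Inference.schematic r σ).HasRefutedPremise P a := by
  obtain ⟨c, hc⟩ := hS.isSeqLinear.exists_seqLabel σ a
  rw [hS.expand_inst hc] at ha
  obtain ⟨n, S, hn, hnot⟩ : ∃ n S, (Inference.schematic r (σ.expand c)).premise n = some S ∧
      ¬ P S := by
    by_contra! hall
    exact ha (hP (.schematic r (σ.expand c)) hr hall)
  obtain ⟨T, hT, rfl⟩ := Option.map_eq_some_iff.1 hn
  rw [← SchematicSequent.expandInst_originLabel_none] at hnot
  exact hP.hasRefutedPremise_of_expandInst hω hT hnot hc fun i m m' α hi _ hm _ =>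
    absurd hm (hS.subst_ne_star m (SchematicSequent.form_mem_of_origin_eq hi) _ α)

lemma Term.ne_star {V : Type} (α : Term V) : α ≠ .star α := fun h => by
  simpa using congrArg sizeOf h

lemma starLRule_origin_form {i : ℕ} {m : Marked}
    (h : starLRule.concl.origin σ (.left i) = some (.form m)) :
    m = box (.star m0) ∧ i = (σ.seq 0).length := by
  refine ⟨by simpa [starLRule, sG, sD, bx] using SchematicSequent.form_mem_of_origin_eq h, ?_⟩
  rcases lt_trichotomy i (σ.seq 0).length with hi | hi | hi
  · simp [SchematicSequent.origin, starLRule, sG, sD, bx, Item.origins, List.getElem?_append,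
      hi] at h
  · exact hi
  · obtain ⟨j, rfl⟩ := Nat.exists_eq_add_of_lt hi
    simp [SchematicSequent.origin, starLRule, sG, sD, bx, Item.origins, List.getElem?_append,
      add_assoc] at h

/-- The label `k` for all displayed `*`-metaformulas. -/
def starLabel (k : ℕ) : Marked → Option ℕ
  | ⟨.star _, _⟩ => some k
  | _ => none

lemma starLRule_concl_expandInst (c : SVar → ℕ → ℕ) (k : ℕ) :
    starLRule.concl.expandInst σ (originLabel c (starLabel k)) =
      (starLOmegaPremise k).inst (σ.expand c) := by
  simp [starLOmegaPremise_inst, SchematicSequent.expandInst, starLRule, sG, sD, bx, box, plain, m0,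
    mS, Item.expandInst, Term.subst, originLabel, starLabel, Instantiation.expand]

lemma starLRule_premise_zero_expandInst (c : SVar → ℕ → ℕ) (k : ℕ) :
    (SchematicSequent.mk [sG, sD] (plain mS)).expandInst σ (originLabel c (starLabel k)) =
      (starLOmegaPremise 0).inst (σ.expand c) := by
  simp [starLOmegaPremise_inst, SchematicSequent.expandInst, sG, sD, plain, mS, Item.expandInst,
    Term.subst, originLabel, Instantiation.expand]

lemma starLRule_premise_one_expandInst (c : SVar → ℕ → ℕ) (k : ℕ) :
    (SchematicSequent.mk [sG, bx m0, bx (.star m0), sD] (plain mS)).expandInst σ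
        (originLabel c (starLabel k)) = (starLOmegaPremise (k + 1)).inst (σ.expand c) := by
  simp [starLOmegaPremise_inst, SchematicSequent.expandInst, sG, sD, bx, box, plain, m0, mS,
    Item.expandInst, Term.subst, originLabel, starLabel, Instantiation.expand, List.replicate_succ]

lemma ClosedUnder.hasRefutedPremise_starLRule (hP : ClosedUnder 𝓡 P) (hω : Rule.starLOmega ∈ 𝓡)
    (ha : ¬ P ((starLRule.concl.inst σ).expand fun i => some (a i))) :
    (Inference.schematic starLRule σ).HasRefutedPremise P a := by
  have hlin : starLRule.concl.IsSeqLinear := by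
    simp [SchematicSequent.IsSeqLinear, starLRule, sG, sD, bx]
  obtain ⟨c, hc⟩ := hlin.exists_seqLabel σ a
  have hconcl : (starLRule.concl.inst σ).expand (fun i => some (a i)) =
      (starLOmegaPremise (a (σ.seq 0).length)).inst (σ.expand c) := by
    rw [← starLRule_concl_expandInst]
    refine SchematicSequent.expand_inst_eq_expandInst fun i u φ hu _ => ?_
    cases u with
    | seq x p => rw [originLabel, hc i x p hu]
    | form m =>
      obtain ⟨rfl, rfl⟩ := starLRule_origin_form hu
      rfl
  rw [hconcl] at ha
  cases hN : a (σ.seq 0).length with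
  | zero =>
    rw [hN, ← starLRule_premise_zero_expandInst c 0] at ha
    exact hP.hasRefutedPremise_of_expandInst hω (n := 0) rfl ha hc fun i m m' α _ hm' =>
      absurd hm' (by simp [sG, sD])
  | succ k =>
    rw [hN, ← starLRule_premise_one_expandInst] at ha
    refine hP.hasRefutedPremise_of_expandInst hω (n := 1) rfl ha hc
      fun i m m' α hm hm' hα hα' => ⟨k, ?_, ?_⟩
    · rw [(starLRule_origin_form hm).2, hN]
      exact k.lt_succ_self
    · obtain ⟨rfl, -⟩ := starLRule_origin_form hm
      obtain rfl | rfl : m' = box m0 ∨ m' = box (.star m0) := by simpa [sG, sD, bx] using hm'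
      · exact absurd (hα'.trans hα.symm) (Term.ne_star _)
      · rfl

variable {R : Set SchematicRule}

lemma ClosedUnder.hasRefutedPremise (hP : ClosedUnder (wellfoundedSystem R).rules P)
    (hR : ∀ r ∈ R, r.concl.IsStarStable) {ι : Inference}
    (hι : ι.rule ∈ (nonWellfoundedSystem R).rules)
    (ha : ¬ P (ι.concl.expand fun i => some (a i))) : ι.HasRefutedPremise P a := by
  have hω : Rule.starLOmega ∈ (wellfoundedSystem R).rules := .inl (.inr rfl)
  cases ι with
  | ident x => exact absurd (hP (.ident x) (.inl (.inl rfl)) nofun) ha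
  | starLOmega σ => simp [nonWellfoundedSystem, Inference.rule] at hι
  | schematic r σ =>
    by_cases hr : r = starLRule
    · subst hr
      exact hP.hasRefutedPremise_starLRule hω ha
    · have hr' : r ∈ principalRules ∪ R := by
        simpa [nonWellfoundedSystem, Inference.rule, hr] using hι
      exact hP.hasRefutedPremise_of_isStarStable hω (.inr ⟨r, hr', rfl⟩)
        (hr'.elim isStarStable_of_mem_principalRules (hR r)) ha

end Refutation

lemma not_progresses_of_decreases {ι : ℕ → Inference} {f : ℕ → ℕ} {a : ℕ → ℕ → ℕ}
    (h : ∀ i, (ι i).Decreases (f i) (ι (i + 1)).concl (a i) (a (i + 1))) :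
    ¬ Progresses ι f := by
  rintro ⟨k, p, α, hthread, hprin⟩
  have hstep (i : ℕ) (hi : k ≤ i) := h i (p i) (p (i + 1)) α (hthread i hi).1
    (hthread (i + 1) (hi.trans i.le_succ)).1 (hthread i hi).2
  have hanti : Antitone fun j => a (k + j) (p (k + j)) :=
    antitone_nat_of_succ_le fun j => (hstep (k + j) (k.le_add_right j)).1
  obtain ⟨m, hm⟩ := WellFoundedLT.antitone_chain_condition hanti
  obtain ⟨i, hi, hpr⟩ := frequently_atTop.1 hprin (k + m)
  obtain ⟨j, rfl⟩ := Nat.exists_eq_add_of_le (le_of_add_le_left hi)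
  have hlt := (hstep (k + j) (k.le_add_right j)).2 hpr
  have hmj : m ≤ j := Nat.add_le_add_iff_left.1 hi
  exact hlt.ne ((hm (j + 1) (hmj.trans j.le_succ)).symm.trans (hm j hmj))

/-- From a refutation of the root one follows refuted premises. The labels decrease along the
resulting branch, which therefore cannot progress. -/
theorem ClosedUnder.of_provable_nonWellfoundedSystem {R : Set SchematicRule}
    (hR : ∀ r ∈ R, r.concl.IsStarStable) {P : Sequent → Prop}
    (hP : ClosedUnder (wellfoundedSystem R).rules P) {S : Sequent}
    (h : (nonWellfoundedSystem R).Provable S) : P S := by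
  obtain ⟨π, hπ, hbranch⟩ := h
  obtain ⟨x₀, hx₀, rfl⟩ := hπ.exists_root
  by_contra hS
  let X := {x : π.Node × (ℕ → ℕ) // ¬ P (x.1.inf.concl.expand fun i => some (x.2 i))}
  have hstep (x : X) : ∃ (n : ℕ) (y : X), y.1.1.path = x.1.1.path ++ [n] ∧
      x.1.1.inf.Decreases n y.1.1.inf.concl x.1.2 y.1.2 := by
    obtain ⟨n, S, a', hn, ha', hdec⟩ :=
      hP.hasRefutedPremise hR (π.rule_mem _ _ x.1.1.tree_path) x.2
    obtain ⟨y, hy, rfl⟩ := x.1.1.exists_child hn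
    exact ⟨n, ⟨(y, a'), ha'⟩, hy, hdec⟩
  choose dir next hpath hdec using hstep
  obtain ⟨a₀, ha₀⟩ : ∃ a₀ : ℕ → ℕ, ¬ P (x₀.inf.concl.expand fun i => some (a₀ i)) := by
    by_contra! hall
    have := hP.of_expand (.inl (.inr rfl)) (p := fun _ => none) fun a _ => hall a
    rw [Sequent.expand, expand_none] at this
    exact hS this
  let x (i : ℕ) : X := next^[i] ⟨(x₀, a₀), ha₀⟩
  have hx (i : ℕ) : x (i + 1) = next (x i) := Function.iterate_succ_apply' ..
  have hpath' (i : ℕ) : (x (i + 1)).1.1.path = (x i).1.1.path ++ [dir (x i)] := by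
    rw [hx, hpath]
  have hprog := hbranch _ (Preproof.isBranch_path (x := fun i => (x i).1.1) hx₀
    fun i => ⟨_, hpath' i⟩)
  refine not_progresses_of_decreases (a := fun i => (x i).1.2) (fun i => ?_)
    (hprog.progresses (fun i => (x i).1.1.tree_path) hpath')
  rw [hx]
  exact hdec (x i)

end ActionLat

open ActionLat in
theorem theoremt_general (R : Set SchematicRule) (hR : ∀ r ∈ R, r.concl.IsStarStable)
    (S : Sequent) : (wellfoundedSystem R).Provable S ↔ (nonWellfoundedSystem R).Provable S :=
  ⟨fun h => h.nonWellfounded,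
    closedUnder_exists_preproof_forall_not_isBranch.of_provable_nonWellfoundedSystem hR⟩

theorem theoremt (R : Set ActionLat.SchematicRule) (hR : ∀ r ∈ R, r.IsLinear)
    (S : ActionLat.Sequent) :
    (ActionLat.wellfoundedSystem R).Provable S ↔ (ActionLat.nonWellfoundedSystem R).Provable S :=
  theoremt_general R (fun r hr => (hR r hr).isStarStable) S
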